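/- **Setting.** Let $M\in\mathbb R^{m\times n}$, $r\in\mathbb N$ and $\varepsilon>0$. Write $|X|_\infty=\max_{i,j}|X_{ij}|$, $|X|_2$ for the Frobenius norm, $\sigma_1(X)\ge\sigma_2(X)\ge\dots$ for the singular values and $\|X\|=\sigma_1(X)$ for the spectral norm. Below, $U,V$ range over $\mathbb R^{m\times r}$ and $\mathbb R^{n\times r}$. Put $\mathrm{OPT}=\min_{U,V}|M-UV^\top|_\infty$, let $(U^\star,V^\star)$ attain this minimum and let $X^\star=U^\star V^{\star\top}$. Assume $\mathrm{OPT}>0$ and $X^\star\neq 0$. Set $$\tau=\frac{\varepsilon\,\mathrm{OPT}}{3\log(2mn)},\qquad \lambda=\frac{2\varepsilon\,\mathrm{OPT}}{3|X^\star|_2^2},\qquad \widehat L=\frac1\tau+\lambda,$$ $$\sigma(X,\tau)=\tau\log\Big(\frac{1}{2mn}\sum_{i,j}\big(e^{X_{ij}/\tau}+e^{-X_{ij}/\tau}\big)\Big),\qquad f(X)=\sigma(M-X,\tau)+\frac\lambda2|X|_2^2 .$$ Let $\widehat X^\star=\widehat U\widehat V^{\top}$, where $(\widehat U,\widehat V)$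 is a global minimizer of $f(UV^\top)$. Since $\widehat X^\star$ has rank at most $r$, it equals its best rank-$r$ approximation $\widehat X^\star_r$. **Algorithm (BFGD).** Let $X_0=-\frac1{\widehat L}\nabla f(0)$. Set $U_0=A\Sigma^{1/2}$ and $V_0=B\Sigma^{1/2}$, where $\Sigma$ is the diagonal matrix of the $r$ largest singular values of $X_0$, and $A$, $B$ have orthonormal columns that are corresponding left and right singular vectors. For $i=0,1,\dots,T-1$ choose any step size $$0<\eta_i\le\frac{1}{15\widehat L\,\big\|\begin{bmatrix}U_i\\V_i\end{bmatrix}\big\|^2+3\|\nabla f(U_iV_i^\top)\|}$$ and, with $G_i=\nabla f(U_iV_i^\top)$ and $E_i=U_i^\top U_i-V_i^\top V_i$, put $$U_{i+1}=U_i-\eta_i\big(G_iV_i+\tfrac14U_iE_i\big),\qquad V_{i+1}=V_i-\eta_i\big(G_i^\top U_i-\tfrac14V_iE_i\big).$$ **Initialization assumption.** $\mathrm{Dist}(U_0,V_0;\widehat X^\star_r)\le\frac{\sqrt2}{10}\,\sigma_r(\widehat X^\star_r)^{1/2}$, where $\mathrm{Dist}(U,V;X)$ is the minimum of $\big(|U-U'|_2^2+|V-V'|_2^2\big)^{1/2}$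 over all $(U',V')$ with $U'V'^\top=X$ and $\sigma_i(U')=\sigma_i(V')=\sigma_i(X)^{1/2}$ for $1\le i\le r$. **Claim.** There is a universal constant $K>0$ (independent of $m,n,r,M,\varepsilon$ and of all choices above) such that after $$T=\left\lceil K\,\sigma_r(\widehat X^\star_r)\left(\frac{\log(mn)}{(\varepsilon\,\mathrm{OPT})^2}+\frac1{|X^\star|_2^2}\right)\right\rceil$$ iterations the output satisfies $$|M-U_TV_T^\top|_\infty\le(1+\varepsilon)\,\mathrm{OPT}.$$ -/

import Mathlib

noncomputable section

namespace BFGD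

/-- The entrywise `ℓ∞` norm `|X|_∞ = max_{i,j} |X i j|`. -/
def entryMax {m n : ℕ} (X : Matrix (Fin m) (Fin n) ℝ) : ℝ :=
  ⨆ p : Fin m × Fin n, |X p.1 p.2|

/-- The squared Frobenius norm `|X|₂² = ∑ i j, (X i j)²`. -/
def frobSq {m n : ℕ} (X : Matrix (Fin m) (Fin n) ℝ) : ℝ :=
  ∑ i, ∑ j, X i j ^ 2

/-- The singular values of a matrix in non-increasing order, numbered from `0`:
`sv X k` is `σ_{k+1}(X)`. -/
def sv {m n : ℕ} (X : Matrix (Fin m) (Fin n) ℝ) (k : ℕ) : ℝ :=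
  (Matrix.toEuclideanLin X).singularValues k

/-- The spectral norm, i.e. the operator norm between Euclidean spaces. -/
def specNorm {ι κ : Type} [Fintype ι] [Fintype κ] [DecidableEq κ] (A : Matrix ι κ ℝ) : ℝ :=
  ‖LinearMap.toContinuousLinearMap (Matrix.toEuclideanLin A)‖

/-- The gradient of a function of a matrix variable: the matrix of its partial derivatives. -/
def grad {m n : ℕ} (f : Matrix (Fin m) (Fin n) ℝ → ℝ) (X : Matrix (Fin m) (Fin n) ℝ) :
    Matrix (Fin m) (Fin n) ℝ :=
  Matrix.of fun i j => deriv (fun t : ℝ => f (X + t • Matrix.single i j (1 : ℝ))) 0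

/-- The symmetrized log-sum-exp function with smoothing parameter `τ`. -/
def logsumexp {m n : ℕ} (X : Matrix (Fin m) (Fin n) ℝ) (τ : ℝ) : ℝ :=
  τ * Real.log
    ((∑ i, ∑ j, (Real.exp (X i j / τ) + Real.exp (-(X i j) / τ))) / (2 * (m : ℝ) * (n : ℝ)))

/-- `OPT = min_{U, V} |M - U Vᵀ|_∞` over `U` with `m` rows, `V` with `n` rows and `r` columns. -/
def opt {m n : ℕ} (r : ℕ) (M : Matrix (Fin m) (Fin n) ℝ) : ℝ :=
  ⨅ p : Matrix (Fin m) (Fin r) ℝ × Matrix (Fin n) (Fin r) ℝ, entryMax (M - p.1 * p.2.transpose)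

/-- `(U, V)` is a global minimizer of the factored problem `min_{U, V} F (U Vᵀ)`. -/
def IsOptimalFactors {m n r : ℕ} (F : Matrix (Fin m) (Fin n) ℝ → ℝ)
    (U : Matrix (Fin m) (Fin r) ℝ) (V : Matrix (Fin n) (Fin r) ℝ) : Prop :=
  ∀ (U' : Matrix (Fin m) (Fin r) ℝ) (V' : Matrix (Fin n) (Fin r) ℝ),
    F (U * V.transpose) ≤ F (U' * V'.transpose)

/-- The smoothed and regularized objective `X ↦ σ(M - X, τ) + (lam / 2) |X|₂²`. -/
def objective {m n : ℕ} (M : Matrix (Fin m) (Fin n) ℝ) (τ lam : ℝ)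
    (X : Matrix (Fin m) (Fin n) ℝ) : ℝ :=
  logsumexp (M - X) τ + lam / 2 * frobSq X

/-- The smoothing parameter `τ = ε OPT / (3 log (2 m n))`. -/
def tauParam (m n : ℕ) (ε OPT : ℝ) : ℝ :=
  ε * OPT / (3 * Real.log (2 * (m : ℝ) * (n : ℝ)))

/-- The regularization parameter `2 ε OPT / (3 |X⋆|₂²)`. -/
def lamParam {m n : ℕ} (ε OPT : ℝ) (Xstar : Matrix (Fin m) (Fin n) ℝ) : ℝ :=
  2 * ε * OPT / (3 * frobSq Xstar)

/-- `U` and `V` are the balanced factors given by an SVD of `X` truncated to its `r` leading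
singular triples: `U = A diag(√s)` and `V = B diag(√s)`, where `s` lists the `r` largest singular
values of `X` and the orthonormal columns of `A` and `B` are corresponding left and right singular
vectors. -/
def IsSVDFactorization {m n r : ℕ} (X : Matrix (Fin m) (Fin n) ℝ)
    (U : Matrix (Fin m) (Fin r) ℝ) (V : Matrix (Fin n) (Fin r) ℝ) : Prop :=
  ∃ (A : Matrix (Fin m) (Fin r) ℝ) (B : Matrix (Fin n) (Fin r) ℝ),
    A.transpose * A = 1 ∧ B.transpose * B = 1 ∧
    X * B = A * Matrix.diagonal (fun k : Fin r => sv X k) ∧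
    X.transpose * A = B * Matrix.diagonal (fun k : Fin r => sv X k) ∧
    U = A * Matrix.diagonal (fun k : Fin r => √(sv X k)) ∧
    V = B * Matrix.diagonal (fun k : Fin r => √(sv X k))

/-- The equally-footed factorizations of a matrix `X` of rank at most `r`: `X = U Vᵀ` and
`σ_i(U) = σ_i(V) = σ_i(X)^{1/2}` for `i = 1, …, r`. -/
def IsEquallyFooted {m n r : ℕ} (X : Matrix (Fin m) (Fin n) ℝ)
    (U : Matrix (Fin m) (Fin r) ℝ) (V : Matrix (Fin n) (Fin r) ℝ) : Prop :=
  U * V.transpose = X ∧ ∀ k : Fin r, sv U k = √(sv X k) ∧ sv V k = √(sv X k)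

/-- `Dist(U, V; X) ≤ ρ`, where `Dist(U, V; X)` is the minimum over the equally-footed
factorizations `(U', V')` of `X` of the Frobenius distance from `[U; V]` to `[U'; V']`. -/
def DistLE {m n r : ℕ} (U : Matrix (Fin m) (Fin r) ℝ) (V : Matrix (Fin n) (Fin r) ℝ)
    (X : Matrix (Fin m) (Fin n) ℝ) (ρ : ℝ) : Prop :=
  ∃ (U' : Matrix (Fin m) (Fin r) ℝ) (V' : Matrix (Fin n) (Fin r) ℝ),
    IsEquallyFooted X U' V' ∧ √(frobSq (U - U') + frobSq (V - V')) ≤ ρ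

/-- `U 0, …, U T` and `V 0, …, V T` are the iterates of bi-factored gradient descent on `f` with
inputs `(r, T, γ, C, L)`, for a strongly convex `f` with Lipschitz gradient. The start is a rank-`r`
SVD of `-(1 / L) ∇f(0)`; in every iteration the step size may be any positive number up to
`C / (15 L ‖[U; V]‖² + 3 ‖∇f(U Vᵀ)‖)`, with spectral norms. -/
structure IsRun {m n r : ℕ} (f : Matrix (Fin m) (Fin n) ℝ → ℝ) (T : ℕ) (γ C L : ℝ)
    (U : ℕ → Matrix (Fin m) (Fin r) ℝ) (V : ℕ → Matrix (Fin n) (Fin r) ℝ) : Prop where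
  init : IsSVDFactorization ((1 / L) • (-grad f 0)) (U 0) (V 0)
  step : ∀ i < T, ∃ η : ℝ, 0 < η ∧
    η ≤ C / (15 * L * specNorm (Matrix.fromRows (U i) (V i)) ^ 2
      + 3 * specNorm (grad f (U i * (V i).transpose))) ∧
    U (i + 1) = U i - η • (grad f (U i * (V i).transpose) * V i
      + γ • (U i * ((U i).transpose * U i - (V i).transpose * V i))) ∧
    V (i + 1) = V i - η • ((grad f (U i * (V i).transpose)).transpose * U i
      - γ • (V i * ((U i).transpose * U i - (V i).transpose * V i)))

/-- A run, for `T` iterations, of the `ℓ∞` low rank approximation solver: bi-factored gradient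
descent on the smoothed objective with `γ = 1/4`, `C = 1` and `L = 1/τ + lam`. -/
def IsLInfSolverRun {m n r : ℕ} (M Xstar : Matrix (Fin m) (Fin n) ℝ) (ε : ℝ) (T : ℕ)
    (U : ℕ → Matrix (Fin m) (Fin r) ℝ) (V : ℕ → Matrix (Fin n) (Fin r) ℝ) : Prop :=
  IsRun (objective M (tauParam m n ε (opt r M)) (lamParam ε (opt r M) Xstar)) T (1 / 4) 1
    (1 / tauParam m n ε (opt r M) + lamParam ε (opt r M) Xstar) U V

/-- The iteration bound `σ_r(Xhat) (log (m n) / (ε OPT)² + 1 / |X⋆|₂²)`. -/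
def iterBound {m n : ℕ} (r : ℕ) (ε OPT : ℝ) (Xstar Xhat : Matrix (Fin m) (Fin n) ℝ) : ℝ :=
  sv Xhat (r - 1) * (Real.log ((m : ℝ) * (n : ℝ)) / (ε * OPT) ^ 2 + 1 / frobSq Xstar)

end BFGD

end

namespace BFGD

open scoped Matrix.Norms.L2Operator
open Matrix

/-! No convergence rate is needed: the starting point already meets the target accuracy, and the
iteration never makes the objective worse. Write `L = 1/τ + λ` and `e = ε · OPT`.

The gradient of `f` at the origin has Frobenius norm at most 1, so `U₀V₀ᵀ` has Frobenius norm at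
most `1/L ≤ τ`. For such small factors the initialization assumption forces `σ_r(X̂) ≤ 3/(2L)` and
puts `U₀V₀ᵀ` entrywise within `3/(10L)` of `X̂` (`DistLE.bounds`), whence `f(U₀V₀ᵀ) ≤ f(X̂) + τ/2`
(`objective_init_le`).

Each iteration is a gradient step for the potential `f(UVᵀ) + |UᵀU - VᵀV|₂²/16`, which does not
increase when `L ≥ 1` (`descent`); the SVD start is balanced, so there the potential equals `f`. The
condition `L ≥ 1` appears because the step size bound scales with `L` while the balancing term does
not. If `L < 1`, the bound on `σ_r(X̂)` leaves at most one iteration (`one_le_of_one_lt`), and a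
step from a balanced point is plain factored descent, valid for every `L ≥ 0`
(`descent_of_balanced`).

The error budget `e` has three parts: `τ log(2mn) = e/3` for smoothing, `e/3` for the regularizer at
`X⋆`, and `τ/2 ≤ e/3` for the start. -/

/-! ### Spectral norm, Frobenius geometry and singular values. -/

theorem norm_transpose {m n : ℕ} (A : Matrix (Fin m) (Fin n) ℝ) : ‖Aᵀ‖ = ‖A‖ := by
  rw [← conjTranspose_eq_transpose_of_trivial, l2_opNorm_conjTranspose]

theorem norm_transpose_mul_self {m n : ℕ} (A : Matrix (Fin m) (Fin n) ℝ) :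
    ‖Aᵀ * A‖ = ‖A‖ * ‖A‖ := by
  rw [← conjTranspose_eq_transpose_of_trivial, l2_opNorm_conjTranspose_mul_self]

/-- The norm of a matrix with orthonormal columns. -/
theorem norm_le_one_of_orthonormal {m n : ℕ} {A : Matrix (Fin m) (Fin n) ℝ} (h : Aᵀ * A = 1) :
    ‖A‖ ≤ 1 := by
  have h1 := norm_transpose_mul_self A
  rw [h, ← diagonal_one, l2_opNorm_diagonal] at h1
  -- Only an inequality, since `Fin n` may be empty.
  have h2 : ‖(fun _ : Fin n => (1 : ℝ))‖ ≤ 1 :=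
    (pi_norm_le_iff_of_nonneg zero_le_one).2 (by simp)
  nlinarith [norm_nonneg A]

/-- The entries of a matrix as a Euclidean vector. -/
noncomputable def flat {m n : ℕ} (X : Matrix (Fin m) (Fin n) ℝ) :
    EuclideanSpace ℝ (Fin m × Fin n) :=
  WithLp.toLp 2 fun p => X p.1 p.2

/-- The Frobenius norm. -/
noncomputable def frob {m n : ℕ} (X : Matrix (Fin m) (Fin n) ℝ) : ℝ := ‖flat X‖

/-- The Frobenius inner product. -/
noncomputable def ip {m n : ℕ} (X Y : Matrix (Fin m) (Fin n) ℝ) : ℝ := inner ℝ (flat X) (flat Y)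

section
variable {m n l : ℕ}

theorem flat_add (X Y : Matrix (Fin m) (Fin n) ℝ) : flat (X + Y) = flat X + flat Y := rfl
theorem flat_sub (X Y : Matrix (Fin m) (Fin n) ℝ) : flat (X - Y) = flat X - flat Y := rfl
theorem flat_smul (c : ℝ) (X : Matrix (Fin m) (Fin n) ℝ) : flat (c • X) = c • flat X := rfl

theorem frob_nonneg (X : Matrix (Fin m) (Fin n) ℝ) : 0 ≤ frob X := norm_nonneg _

theorem frob_add_le (X Y : Matrix (Fin m) (Fin n) ℝ) : frob (X + Y) ≤ frob X + frob Y := by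
  rw [frob, flat_add]; exact norm_add_le _ _

theorem frob_sub_le (X Y : Matrix (Fin m) (Fin n) ℝ) : frob (X - Y) ≤ frob X + frob Y := by
  rw [frob, flat_sub]; exact norm_sub_le _ _

theorem frob_smul (c : ℝ) (X : Matrix (Fin m) (Fin n) ℝ) : frob (c • X) = |c| * frob X := by
  rw [frob, flat_smul]; exact norm_smul _ _

theorem frob_sq (X : Matrix (Fin m) (Fin n) ℝ) : frob X ^ 2 = frobSq X := by
  simp [frob, flat, frobSq, EuclideanSpace.norm_sq_eq, Fintype.sum_prod_type]

theorem frobSq_nonneg (X : Matrix (Fin m) (Fin n) ℝ) : 0 ≤ frobSq X := by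
  rw [← frob_sq]; positivity

theorem ip_eq_sum (X Y : Matrix (Fin m) (Fin n) ℝ) : ip X Y = ∑ i, ∑ j, X i j * Y i j := by
  simp [ip, flat, PiLp.inner_apply, Fintype.sum_prod_type, mul_comm]

theorem ip_eq_trace (X Y : Matrix (Fin m) (Fin n) ℝ) : ip X Y = (Xᵀ * Y).trace := by
  rw [ip_eq_sum, Finset.sum_comm]
  simp [trace, mul_apply]

theorem ip_self (X : Matrix (Fin m) (Fin n) ℝ) : ip X X = frobSq X := by
  rw [← frob_sq, frob, ip, real_inner_self_eq_norm_sq]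

theorem ip_comm (X Y : Matrix (Fin m) (Fin n) ℝ) : ip X Y = ip Y X := real_inner_comm _ _

theorem ip_add_left (X Y Z : Matrix (Fin m) (Fin n) ℝ) : ip (X + Y) Z = ip X Z + ip Y Z := by
  rw [ip, flat_add]; exact inner_add_left _ _ _

theorem ip_sub_left (X Y Z : Matrix (Fin m) (Fin n) ℝ) : ip (X - Y) Z = ip X Z - ip Y Z := by
  rw [ip, flat_sub]; exact inner_sub_left _ _ _

theorem ip_smul_left (c : ℝ) (X Z : Matrix (Fin m) (Fin n) ℝ) : ip (c • X) Z = c * ip X Z := by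
  rw [ip, flat_smul]; exact real_inner_smul_left _ _ _

theorem ip_add_right (X Y Z : Matrix (Fin m) (Fin n) ℝ) : ip Z (X + Y) = ip Z X + ip Z Y := by
  rw [ip, flat_add]; exact inner_add_right _ _ _

theorem ip_sub_right (X Y Z : Matrix (Fin m) (Fin n) ℝ) : ip Z (X - Y) = ip Z X - ip Z Y := by
  rw [ip, flat_sub]; exact inner_sub_right _ _ _

theorem ip_smul_right (c : ℝ) (X Z : Matrix (Fin m) (Fin n) ℝ) : ip Z (c • X) = c * ip Z X := by
  rw [ip, flat_smul]; exact real_inner_smul_right _ _ _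

theorem abs_ip_le (X Y : Matrix (Fin m) (Fin n) ℝ) : |ip X Y| ≤ frob X * frob Y :=
  abs_real_inner_le_norm _ _

theorem frobSq_add (X Y : Matrix (Fin m) (Fin n) ℝ) :
    frobSq (X + Y) = frobSq X + 2 * ip X Y + frobSq Y := by
  simp only [← ip_self, ip_add_left, ip_add_right, ip_comm Y X]; ring

theorem ip_mul_transpose_left (G : Matrix (Fin m) (Fin n) ℝ) (P : Matrix (Fin m) (Fin l) ℝ)
    (V : Matrix (Fin n) (Fin l) ℝ) : ip G (P * Vᵀ) = ip (G * V) P := by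
  rw [ip_eq_trace, ip_eq_trace, transpose_mul, ← Matrix.mul_assoc, trace_mul_comm,
    Matrix.mul_assoc]

theorem ip_mul_transpose_right (G : Matrix (Fin m) (Fin n) ℝ) (U : Matrix (Fin m) (Fin l) ℝ)
    (Q : Matrix (Fin n) (Fin l) ℝ) : ip G (U * Qᵀ) = ip (Gᵀ * U) Q := by
  rw [ip_mul_transpose_left, ip_comm (Gᵀ * U), ip_eq_trace, ip_eq_trace, transpose_mul,
    ← Matrix.mul_assoc]

/-- With `ip_transpose_mul'`: against a symmetric matrix, both cross terms of a perturbed Gram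
matrix contribute equally. -/
theorem ip_transpose_mul (E : Matrix (Fin n) (Fin n) ℝ) (hE : Eᵀ = E)
    (P U : Matrix (Fin m) (Fin n) ℝ) : ip E (Pᵀ * U) = ip (U * E) P := by
  rw [ip_eq_trace, ip_comm, ip_eq_trace, ← Matrix.mul_assoc, hE, Matrix.mul_assoc,
    trace_mul_comm, Matrix.mul_assoc]

theorem ip_transpose_mul' (E : Matrix (Fin n) (Fin n) ℝ) (hE : Eᵀ = E)
    (P U : Matrix (Fin m) (Fin n) ℝ) : ip E (Uᵀ * P) = ip (U * E) P := by
  rw [ip_eq_trace, ip_eq_trace, transpose_mul, Matrix.mul_assoc, hE]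

theorem frobSq_transpose (X : Matrix (Fin m) (Fin n) ℝ) : frobSq Xᵀ = frobSq X := by
  simp only [frobSq, transpose_apply]; exact Finset.sum_comm

theorem frob_eq_sqrt (X : Matrix (Fin m) (Fin n) ℝ) : frob X = √(frobSq X) := by
  rw [← frob_sq, Real.sqrt_sq (frob_nonneg X)]

theorem frob_transpose (X : Matrix (Fin m) (Fin n) ℝ) : frob Xᵀ = frob X := by
  rw [frob_eq_sqrt, frob_eq_sqrt, frobSq_transpose]

theorem abs_entry_le_frob (X : Matrix (Fin m) (Fin n) ℝ) (i : Fin m) (j : Fin n) :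
    |X i j| ≤ frob X :=
  PiLp.norm_apply_le (flat X) (i, j)

theorem sum_mulVec_sq_le (A : Matrix (Fin m) (Fin n) ℝ) (x : Fin n → ℝ) :
    ∑ i, (A *ᵥ x) i ^ 2 ≤ ‖A‖ ^ 2 * ∑ j, x j ^ 2 := by
  have h := l2_opNorm_mulVec A (WithLp.toLp 2 x)
  have h2 := pow_le_pow_left₀ (norm_nonneg _) h 2
  rw [mul_pow, EuclideanSpace.norm_sq_eq, EuclideanSpace.norm_sq_eq] at h2
  simpa using h2

/-- Apply the operator norm bound to each column of `B` and sum the squares. -/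
theorem frob_mul_le (A : Matrix (Fin m) (Fin n) ℝ) (B : Matrix (Fin n) (Fin l) ℝ) :
    frob (A * B) ≤ ‖A‖ * frob B := by
  refine abs_le_of_sq_le_sq' ?_ (mul_nonneg (norm_nonneg _) (frob_nonneg _)) |>.2
  rw [mul_pow, frob_sq, frob_sq, ← frobSq_transpose, ← frobSq_transpose B, frobSq, frobSq,
    Finset.mul_sum]
  refine Finset.sum_le_sum fun k _ => ?_
  exact sum_mulVec_sq_le A (fun j => B j k)

theorem frob_mul_le' (A : Matrix (Fin m) (Fin n) ℝ) (B : Matrix (Fin n) (Fin l) ℝ) :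
    frob (A * B) ≤ frob A * ‖B‖ := by
  rw [← frob_transpose, transpose_mul, mul_comm, ← frob_transpose A, ← norm_transpose B]
  exact frob_mul_le _ _

theorem norm_le_frob (X : Matrix (Fin m) (Fin n) ℝ) : ‖X‖ ≤ frob X := by
  refine ContinuousLinearMap.opNorm_le_bound _ (frob_nonneg X) fun x => ?_
  refine abs_le_of_sq_le_sq' ?_ (mul_nonneg (frob_nonneg _) (norm_nonneg _)) |>.2
  rw [mul_pow, EuclideanSpace.norm_sq_eq, EuclideanSpace.norm_sq_eq, frob_sq, frobSq,
    Finset.sum_mul]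
  refine Finset.sum_le_sum fun i _ => ?_
  simp only [Real.norm_eq_abs, sq_abs]
  exact Finset.sum_mul_sq_le_sq_mul_sq Finset.univ (X i) x.ofLp

/-- Dropping coordinates of the stacked image only shortens it. Hence the one norm in the step size
rule controls both factors. -/
theorem norm_le_fromRows_left (U : Matrix (Fin m) (Fin l) ℝ) (V : Matrix (Fin n) (Fin l) ℝ) :
    ‖U‖ ≤ specNorm (fromRows U V) := by
  refine ContinuousLinearMap.opNorm_le_bound _ (norm_nonneg _) fun x => ?_
  refine le_trans ?_ (ContinuousLinearMap.le_opNorm _ x)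
  refine abs_le_of_sq_le_sq' ?_ (norm_nonneg _) |>.2
  rw [EuclideanSpace.norm_sq_eq, EuclideanSpace.norm_sq_eq, Fintype.sum_sum_type]
  exact le_add_of_nonneg_right (by positivity)

theorem norm_le_fromRows_right (U : Matrix (Fin m) (Fin l) ℝ) (V : Matrix (Fin n) (Fin l) ℝ) :
    ‖V‖ ≤ specNorm (fromRows U V) := by
  refine ContinuousLinearMap.opNorm_le_bound _ (norm_nonneg _) fun x => ?_
  refine le_trans ?_ (ContinuousLinearMap.le_opNorm _ x)
  refine abs_le_of_sq_le_sq' ?_ (norm_nonneg _) |>.2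
  rw [EuclideanSpace.norm_sq_eq, EuclideanSpace.norm_sq_eq, Fintype.sum_sum_type]
  exact le_add_of_nonneg_left (by positivity)

theorem sv_nonneg (X : Matrix (Fin m) (Fin n) ℝ) (k : ℕ) : 0 ≤ sv X k :=
  LinearMap.singularValues_nonneg _ _

/-- Every singular value is at most the spectral norm. -/
theorem sv_le_norm (X : Matrix (Fin m) (Fin n) ℝ) (k : ℕ) : sv X k ≤ ‖X‖ := by
  by_cases hk : k < Module.finrank ℝ (EuclideanSpace ℝ (Fin n))
  · obtain ⟨v, hv⟩ :=
      (LinearMap.hasEigenvalue_adjoint_comp_self_sq_singularValues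
        (Matrix.toEuclideanLin X) hk).exists_hasEigenvector
    have h1 : ‖toEuclideanLin X v‖ ^ 2 = sv X k ^ 2 * ‖v‖ ^ 2 := by
      rw [← real_inner_self_eq_norm_sq, ← real_inner_self_eq_norm_sq,
        ← LinearMap.adjoint_inner_left, ← LinearMap.comp_apply, hv.apply_eq_smul,
        real_inner_smul_left]
      rfl
    have h2 : ‖toEuclideanLin X v‖ ≤ ‖X‖ * ‖v‖ :=
      (LinearMap.toContinuousLinearMap (toEuclideanLin X)).le_opNorm v
    have h3 : 0 < ‖v‖ := norm_pos_iff.2 hv.2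
    rw [← mul_pow] at h1
    have h4 : sv X k * ‖v‖ ≤ ‖X‖ * ‖v‖ := by
      rw [← (pow_left_inj₀ (norm_nonneg _) (by have := sv_nonneg X k; positivity) two_ne_zero).1 h1]
      exact h2
    exact le_of_mul_le_mul_right h4 h3
  · rw [sv, LinearMap.singularValues_of_finrank_le _ (not_lt.1 hk)]
    exact norm_nonneg X

end

/-! ### The smoothed objective: approximation, gradient and smoothness. -/

/-- A quadratic upper bound for the log-sum-exp function, in exponential form. -/
theorem sum_exp_add_le {ι : Type} [Fintype ι] [Nonempty ι] (x d : ι → ℝ) {D : ℝ}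
    (hd : ∀ k, |d k| ≤ D) :
    ∑ k, Real.exp (x k + d k) ≤ (∑ k, Real.exp (x k)) *
      Real.exp ((∑ k, Real.exp (x k) * d k) / (∑ k, Real.exp (x k)) + 2 * D ^ 2) := by
  have hS : 0 < ∑ k, Real.exp (x k) := Finset.sum_pos (fun k _ => Real.exp_pos _) Finset.univ_nonempty
  set S := ∑ k, Real.exp (x k) with hSdef
  obtain ⟨k0⟩ := ‹Nonempty ι›
  have hD : 0 ≤ D := (abs_nonneg _).trans (hd k0)
  set μ := (∑ k, Real.exp (x k) * d k) / S with hμ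
  have hμS : S * μ = ∑ k, Real.exp (x k) * d k := by rw [hμ]; field_simp
  -- For `D ≤ 1`, use `exp d ≤ 1 + d + d²`. For `D ≥ 1` the crude bound `exp d ≤ exp D` suffices,
  -- because the weighted mean satisfies `μ ≥ -D` and so `D ≤ μ + 2D²`.
  rcases le_total D 1 with h1 | h1
  · calc ∑ k, Real.exp (x k + d k) ≤ ∑ k, Real.exp (x k) * (1 + d k + D ^ 2) := by
          refine Finset.sum_le_sum fun k _ => ?_
          rw [Real.exp_add]
          refine mul_le_mul_of_nonneg_left ?_ (Real.exp_pos _).le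
          have h2 := (abs_le.1 (Real.abs_exp_sub_one_sub_id_le ((hd k).trans h1))).2
          have h3 : d k ^ 2 ≤ D ^ 2 := sq_le_sq' (abs_le.1 (hd k)).1 (abs_le.1 (hd k)).2
          linarith
      _ = S * (1 + μ + D ^ 2) := by
          have h4 : ∑ k, Real.exp (x k) * (1 + d k + D ^ 2)
              = (∑ k, Real.exp (x k)) * (1 + D ^ 2) + ∑ k, Real.exp (x k) * d k := by
            rw [Finset.sum_mul, ← Finset.sum_add_distrib]
            exact Finset.sum_congr rfl fun k _ => by ring
          rw [h4, ← hμS]; ring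
      _ ≤ S * Real.exp (μ + 2 * D ^ 2) := by
          refine mul_le_mul_of_nonneg_left ?_ hS.le
          nlinarith [Real.add_one_le_exp (μ + 2 * D ^ 2), sq_nonneg D]
  · have hμD : -D ≤ μ := by
      rw [hμ, le_div_iff₀ hS, hSdef, Finset.mul_sum]
      refine Finset.sum_le_sum fun k _ => ?_
      nlinarith [Real.exp_pos (x k), (abs_le.1 (hd k)).1]
    calc ∑ k, Real.exp (x k + d k) ≤ ∑ k, Real.exp (x k) * Real.exp D := by
          refine Finset.sum_le_sum fun k _ => ?_
          rw [← Real.exp_add]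
          exact Real.exp_le_exp.2 (by linarith [(abs_le.1 (hd k)).2])
      _ = S * Real.exp D := by rw [Finset.sum_mul]
      _ ≤ _ := by
          refine mul_le_mul_of_nonneg_left (Real.exp_le_exp.2 ?_) hS.le
          nlinarith

section
variable {m n : ℕ}

/-- The entries of a matrix together with their negatives. -/
def signed (X : Matrix (Fin m) (Fin n) ℝ) : (Fin m × Fin n) ⊕ (Fin m × Fin n) → ℝ :=
  Sum.elim (fun p => X p.1 p.2) (fun p => -X p.1 p.2)

/-- The partition function of the symmetrized log-sum-exp. -/
noncomputable def partition (X : Matrix (Fin m) (Fin n) ℝ) (τ : ℝ) : ℝ :=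
  ∑ k, Real.exp (signed X k / τ)

/-- The entrywise differences `exp (X i j / τ) - exp (-X i j / τ)`. -/
noncomputable def expDiff (X : Matrix (Fin m) (Fin n) ℝ) (τ : ℝ) : Matrix (Fin m) (Fin n) ℝ :=
  Matrix.of fun i j => Real.exp (X i j / τ) - Real.exp (-(X i j) / τ)

theorem partition_eq (X : Matrix (Fin m) (Fin n) ℝ) (τ : ℝ) :
    partition X τ = ∑ i, ∑ j, (Real.exp (X i j / τ) + Real.exp (-(X i j) / τ)) := by
  simp [partition, signed, Fintype.sum_sum_type, Fintype.sum_prod_type, Finset.sum_add_distrib]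

theorem logsumexp_eq (X : Matrix (Fin m) (Fin n) ℝ) (τ : ℝ) :
    logsumexp X τ = τ * Real.log (partition X τ / (2 * (m : ℝ) * (n : ℝ))) := by
  rw [partition_eq]; rfl

theorem sum_exp_mul_signed (X D : Matrix (Fin m) (Fin n) ℝ) (τ : ℝ) :
    ∑ k, Real.exp (signed X k / τ) * signed D k = ip (expDiff X τ) D := by
  simp only [ip_eq_sum, signed, Fintype.sum_sum_type, Fintype.sum_prod_type, expDiff, sub_mul,
    Finset.sum_sub_distrib, Sum.elim_inl, Sum.elim_inr, mul_neg, Finset.sum_neg_distrib, of_apply]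
  ring

theorem signed_add (X Y : Matrix (Fin m) (Fin n) ℝ) (k) :
    signed (X + Y) k = signed X k + signed Y k := by
  rcases k with k | k
  · rfl
  · simp [signed]; ring

theorem signed_smul (c : ℝ) (X : Matrix (Fin m) (Fin n) ℝ) (k) :
    signed (c • X) k = c * signed X k := by
  rcases k with k | k <;> simp [signed]

theorem abs_signed_le {X : Matrix (Fin m) (Fin n) ℝ} {δ : ℝ} (h : ∀ i j, |X i j| ≤ δ) (k) :
    |signed X k| ≤ δ := by
  rcases k with k | k
  · exact h _ _
  · simpa [signed] using h k.1 k.2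

/-- Entrywise `|eᵃ - e⁻ᵃ| ≤ eᵃ + e⁻ᵃ`, and the `ℓ²` norm of a nonnegative family is at most its sum.
-/
theorem frobSq_expDiff_le (X : Matrix (Fin m) (Fin n) ℝ) (τ : ℝ) :
    frobSq (expDiff X τ) ≤ partition X τ ^ 2 := by
  rw [partition_eq, frobSq, ← Fintype.sum_prod_type', ← Fintype.sum_prod_type']
  refine le_trans (Finset.sum_le_sum fun p _ => ?_)
    (Finset.sum_sq_le_sq_sum_of_nonneg fun _ _ => by positivity)
  have h1 := Real.exp_pos (X p.1 p.2 / τ)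
  have h2 := Real.exp_pos (-(X p.1 p.2) / τ)
  simp only [expDiff, of_apply]
  nlinarith [mul_pos h1 h2]

variable [NeZero m] [NeZero n]

theorem partition_pos (X : Matrix (Fin m) (Fin n) ℝ) (τ : ℝ) : 0 < partition X τ :=
  Finset.sum_pos (fun _ _ => Real.exp_pos _) Finset.univ_nonempty

theorem two_mul_card_pos (m n : ℕ) [NeZero m] [NeZero n] : (2 : ℝ) ≤ 2 * (m : ℝ) * (n : ℝ) := by
  have h1 : (1 : ℝ) ≤ m := by exact_mod_cast NeZero.one_le
  have h2 : (1 : ℝ) ≤ n := by exact_mod_cast NeZero.one_le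
  nlinarith

theorem logsumexp_eq_sub (X : Matrix (Fin m) (Fin n) ℝ) (τ : ℝ) :
    logsumexp X τ = τ * Real.log (partition X τ) - τ * Real.log (2 * (m : ℝ) * (n : ℝ)) := by
  rw [logsumexp_eq, Real.log_div (partition_pos X τ).ne' (by linarith [two_mul_card_pos m n])]
  ring

theorem entryMax_le {X : Matrix (Fin m) (Fin n) ℝ} {δ : ℝ} (h : ∀ i j, |X i j| ≤ δ) :
    entryMax X ≤ δ := ciSup_le fun _ => h _ _

theorem abs_le_entryMax {m n : ℕ} (X : Matrix (Fin m) (Fin n) ℝ) (i : Fin m) (j : Fin n) :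
    |X i j| ≤ entryMax X :=
  le_ciSup (f := fun p : Fin m × Fin n => |X p.1 p.2|) (Set.finite_range _).bddAbove (i, j)

/-- The partition function dominates each of its terms, and every `|X i j|` is one of the signed
entries. -/
theorem entryMax_le_logsumexp (X : Matrix (Fin m) (Fin n) ℝ) {τ : ℝ} (hτ : 0 < τ) :
    entryMax X ≤ logsumexp X τ + τ * Real.log (2 * (m : ℝ) * (n : ℝ)) := by
  rw [logsumexp_eq_sub, sub_add_cancel]
  refine entryMax_le fun i j => ?_
  have key : ∀ k, signed X k ≤ τ * Real.log (partition X τ) := fun k => by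
    rw [← div_le_iff₀' hτ, Real.le_log_iff_exp_le (partition_pos X τ)]
    exact Finset.single_le_sum (f := fun k => Real.exp (signed X k / τ))
      (fun _ _ => (Real.exp_pos _).le) (Finset.mem_univ k)
  exact abs_le'.2 ⟨key (Sum.inl (i, j)), key (Sum.inr (i, j))⟩

/-- An entrywise change of at most `δ` multiplies each exponential by at most `exp (δ / τ)`:
log-sum-exp is 1-Lipschitz for the max norm. -/
theorem logsumexp_le_add {X Y : Matrix (Fin m) (Fin n) ℝ} {τ δ : ℝ} (hτ : 0 < τ)
    (h : ∀ i j, |(X - Y) i j| ≤ δ) : logsumexp X τ ≤ logsumexp Y τ + δ := by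
  have h1 : partition X τ ≤ partition Y τ * Real.exp (δ / τ) := by
    rw [partition, partition, Finset.sum_mul]
    refine Finset.sum_le_sum fun k _ => ?_
    rw [← Real.exp_add, ← add_div]
    refine Real.exp_le_exp.2 (div_le_div_of_nonneg_right ?_ hτ.le)
    have h2 := signed_add Y (X - Y) k
    rw [add_sub_cancel] at h2
    linarith [(abs_le.1 (abs_signed_le h k)).2]
  have h3 := Real.log_le_log (partition_pos X τ) h1
  rw [Real.log_mul (partition_pos Y τ).ne' (Real.exp_pos _).ne', Real.log_exp] at h3
  rw [logsumexp_eq_sub, logsumexp_eq_sub]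
  have h4 := mul_le_mul_of_nonneg_left h3 hτ.le
  rw [mul_add, mul_div_cancel₀ _ hτ.ne'] at h4
  linarith

theorem logsumexp_zero (τ : ℝ) : logsumexp (0 : Matrix (Fin m) (Fin n) ℝ) τ = 0 := by
  have h : (m : ℝ) ≠ 0 := by exact_mod_cast NeZero.ne m
  have h' : (n : ℝ) ≠ 0 := by exact_mod_cast NeZero.ne n
  rw [logsumexp_eq, partition_eq]
  have h2 : (2 : ℝ) * m * n ≠ 0 := by positivity
  simp only [Matrix.zero_apply, neg_zero, zero_div, Real.exp_zero, Finset.sum_const, Finset.card_univ,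
    Fintype.card_fin, nsmul_eq_mul]
  rw [show (m : ℝ) * (n * (1 + 1)) = 2 * m * n by ring, div_self h2, Real.log_one, mul_zero]

theorem logsumexp_le_entryMax (X : Matrix (Fin m) (Fin n) ℝ) {τ : ℝ} (hτ : 0 < τ) :
    logsumexp X τ ≤ entryMax X := by
  have h := logsumexp_le_add (X := X) (Y := 0) hτ (δ := entryMax X)
    (fun i j => by rw [sub_zero]; exact abs_le_entryMax X i j)
  rwa [logsumexp_zero, zero_add] at h

theorem logsumexp_add_le (X D : Matrix (Fin m) (Fin n) ℝ) {τ : ℝ} (hτ : 0 < τ) :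
    logsumexp (X + D) τ ≤ logsumexp X τ + ip (expDiff X τ) D / partition X τ
      + 2 / τ * frobSq D := by
  have h1 := sum_exp_add_le (fun k => signed X k / τ) (fun k => signed D k / τ)
    (D := frob D / τ) (fun k => by
      rw [abs_div, abs_of_pos hτ]
      exact div_le_div_of_nonneg_right (abs_signed_le (abs_entry_le_frob D) k) hτ.le)
  have h2 : ∑ k, Real.exp (signed X k / τ + signed D k / τ) = partition (X + D) τ :=
    Finset.sum_congr rfl fun k _ => by rw [signed_add, add_div]
  have h3 : ∑ k, Real.exp (signed X k / τ) * (signed D k / τ) = ip (expDiff X τ) D / τ := by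
    rw [← sum_exp_mul_signed, Finset.sum_div]
    exact Finset.sum_congr rfl fun k _ => by ring
  have h4 : ∑ k, Real.exp (signed X k / τ) = partition X τ := rfl
  rw [h2, h3, h4] at h1
  have h5 := Real.log_le_log (partition_pos _ τ) h1
  rw [Real.log_mul (partition_pos X τ).ne' (Real.exp_pos _).ne', Real.log_exp] at h5
  have h6 := mul_le_mul_of_nonneg_left h5 hτ.le
  have h7 : τ * (Real.log (partition X τ) + (ip (expDiff X τ) D / τ / partition X τ
      + 2 * (frob D / τ) ^ 2)) = τ * Real.log (partition X τ)
        + ip (expDiff X τ) D / partition X τ + 2 / τ * frobSq D := by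
    rw [← frob_sq]; have := (partition_pos X τ).ne'; field_simp; ring
  rw [logsumexp_eq_sub, logsumexp_eq_sub]
  linarith

theorem hasDerivAt_objective (M X D : Matrix (Fin m) (Fin n) ℝ) {τ : ℝ} (hτ : 0 < τ) (lam : ℝ) :
    HasDerivAt (fun t : ℝ => objective M τ lam (X + t • D))
      (ip (lam • X - (partition (M - X) τ)⁻¹ • expDiff (M - X) τ) D) 0 := by
  have h1 : HasDerivAt (fun t : ℝ => partition (M - (X + t • D)) τ)
      (∑ k, Real.exp (signed (M - X) k / τ) * (-signed D k / τ)) 0 := by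
    refine HasDerivAt.fun_sum fun k _ => ?_
    have h2 : ∀ t : ℝ, signed (M - (X + t • D)) k = signed (M - X) k + t * (-signed D k) := by
      intro t
      have : M - (X + t • D) = (M - X) + (-t) • D := by rw [neg_smul]; abel
      rw [this, signed_add, signed_smul]; ring
    simp only [h2]
    have h3 : HasDerivAt (fun t : ℝ => (signed (M - X) k + t * (-signed D k)) / τ)
        (-signed D k / τ) 0 := by
      have := (((hasDerivAt_id (0 : ℝ)).mul_const (-signed D k)).const_add
        (signed (M - X) k)).div_const τ
      simpa using this
    simpa using h3.exp
  have hZ : partition (M - (X + (0 : ℝ) • D)) τ = partition (M - X) τ := by simp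
  have h4 := ((h1.log (by rw [hZ]; exact (partition_pos _ τ).ne')).const_mul τ).sub_const
    (τ * Real.log (2 * (m : ℝ) * (n : ℝ)))
  have h5 : HasDerivAt (fun t : ℝ => lam / 2 * frobSq (X + t • D)) (lam * ip X D) 0 := by
    have h6 : ∀ t : ℝ, lam / 2 * frobSq (X + t • D)
        = lam / 2 * frobSq X + t * (lam * ip X D) + t ^ 2 * (lam / 2 * frobSq D) := by
      intro t
      rw [frobSq_add, ip_smul_right, ← frob_sq (t • D), frob_smul, mul_pow, sq_abs, frob_sq]; ring
    simp only [h6]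
    have := (((hasDerivAt_id (0 : ℝ)).mul_const (lam * ip X D)).const_add
      (lam / 2 * frobSq X)).fun_add
      (((hasDerivAt_id (0 : ℝ)).pow 2).mul_const (lam / 2 * frobSq D))
    simpa using this
  have h7 := h4.add h5
  have h8 : ∑ k, Real.exp (signed (M - X) k / τ) * (-signed D k / τ)
      = - (ip (expDiff (M - X) τ) D / τ) := by
    rw [← sum_exp_mul_signed, Finset.sum_div, ← Finset.sum_neg_distrib]
    exact Finset.sum_congr rfl fun k _ => by ring
  rw [h8, hZ] at h7
  convert! h7 using 1
  · funext t
    simp only [objective, logsumexp_eq_sub, Pi.add_apply]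
  · rw [ip_sub_left, ip_smul_left, ip_smul_left]
    have := (partition_pos (M - X) τ).ne'
    field_simp
    ring

theorem ip_single {m n : ℕ} (A : Matrix (Fin m) (Fin n) ℝ) (i : Fin m) (j : Fin n) :
    ip A (Matrix.single i j 1) = A i j := by
  rw [ip_eq_sum, Finset.sum_eq_single i, Finset.sum_eq_single j]
  · simp
  · intro b _ hb; simp [Matrix.single, hb.symm]
  · simp
  · intro b _ hb; simp [Matrix.single, hb.symm]
  · simp

theorem grad_objective (M X : Matrix (Fin m) (Fin n) ℝ) {τ : ℝ} (hτ : 0 < τ) (lam : ℝ) :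
    grad (objective M τ lam) X
      = lam • X - (partition (M - X) τ)⁻¹ • expDiff (M - X) τ := by
  ext i j
  rw [grad, of_apply, (hasDerivAt_objective M X _ hτ lam).deriv, ip_single]

/-- The objective has a Lipschitz gradient, up to the constant. -/
theorem objective_add_le (M X D : Matrix (Fin m) (Fin n) ℝ) {τ lam : ℝ} (hτ : 0 < τ)
    (hlam : 0 ≤ lam) :
    objective M τ lam (X + D) ≤ objective M τ lam X + ip (grad (objective M τ lam) X) D
      + 2 * (1 / τ + lam) * frobSq D := by
  have h1 := logsumexp_add_le (M - X) ((-1 : ℝ) • D) hτ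
  have h2 : M - X + (-1 : ℝ) • D = M - (X + D) := by rw [neg_one_smul]; abel
  rw [h2, ip_smul_right, ← frob_sq ((-1 : ℝ) • D), frob_smul, mul_pow, sq_abs, frob_sq] at h1
  rw [grad_objective M X hτ, ip_sub_left, ip_smul_left, ip_smul_left]
  simp only [objective]
  rw [frobSq_add]
  have h3 := mul_nonneg hlam (frobSq_nonneg D)
  have h4 : -1 * ip (expDiff (M - X) τ) D / partition (M - X) τ
    = - ((partition (M - X) τ)⁻¹ * ip (expDiff (M - X) τ) D) := by ring
  have h5 : 2 / τ * ((-1) ^ 2 * frobSq D) = 2 * (1 / τ) * frobSq D := by ring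
  rw [h4, h5] at h1
  nlinarith

/-- The gradient at the origin has Frobenius norm at most `1`. -/
theorem frob_grad_zero_le (M : Matrix (Fin m) (Fin n) ℝ) {τ lam : ℝ} (hτ : 0 < τ) :
    frob (grad (objective M τ lam) 0) ≤ 1 := by
  have hZ := partition_pos M τ
  rw [grad_objective M 0 hτ, smul_zero, zero_sub, sub_zero, ← neg_smul, frob_smul, abs_neg,
    abs_of_pos (inv_pos.2 hZ), inv_mul_le_one₀ hZ]
  refine abs_le_of_sq_le_sq' ?_ hZ.le |>.2
  rw [frob_sq]; exact frobSq_expDiff_le M τ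

end

/-! ### Descent of a single factored step. -/

section
variable {m n r : ℕ}

/-- The effect of a factored step on a smooth function of the product. -/
theorem factored_step_le {f : Matrix (Fin m) (Fin n) ℝ → ℝ} {G : Matrix (Fin m) (Fin n) ℝ}
    {L w η : ℝ} {U P : Matrix (Fin m) (Fin r) ℝ} {V Q : Matrix (Fin n) (Fin r) ℝ}
    (hf : ∀ D, f (U * Vᵀ + D) ≤ f (U * Vᵀ) + ip G D + 2 * L * frobSq D)
    (hL : 0 ≤ L) (hη : 0 ≤ η) (hU : ‖U‖ ≤ w) (hV : ‖V‖ ≤ w)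
    (hstep : η * (15 * L * w ^ 2 + 3 * ‖G‖) ≤ 1) (hP : η * ‖P‖ ≤ 2 / 5 * w) :
    f ((U - η • P) * (V - η • Q)ᵀ) ≤ f (U * Vᵀ) - η * (ip (G * V) P + ip (Gᵀ * U) Q)
      + 3 / 5 * η * (frobSq P + frobSq Q) := by
  have hw : 0 ≤ w := (norm_nonneg _).trans hU
  have hp := frob_nonneg P
  have hq := frob_nonneg Q
  rw [← frob_sq P, ← frob_sq Q]
  set p := frob P with hpdef
  set q := frob Q with hqdef
  set D := (-η) • (P * Vᵀ + U * Qᵀ) + η ^ 2 • (P * Qᵀ) with hD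
  have hX : (U - η • P) * (V - η • Q)ᵀ = U * Vᵀ + D := by
    rw [hD, transpose_sub, transpose_smul, Matrix.sub_mul, Matrix.mul_sub, Matrix.mul_sub]
    simp only [Matrix.smul_mul, Matrix.mul_smul, smul_smul, smul_add, neg_smul, pow_two]
    abel
  have h1 : ip G D ≤ -(η * (ip (G * V) P + ip (Gᵀ * U) Q)) + η ^ 2 * (‖G‖ * q * p) := by
    have h2 : ip (G * Q) P ≤ ‖G‖ * q * p :=
      (le_abs_self _).trans ((abs_ip_le _ _).trans
        (mul_le_mul_of_nonneg_right (frob_mul_le G Q) hp))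
    have h3 := mul_le_mul_of_nonneg_left h2 (sq_nonneg η)
    rw [hD, ip_add_right, ip_smul_right, ip_smul_right, ip_add_right, ip_mul_transpose_left,
      ip_mul_transpose_right, ip_mul_transpose_left]
    linarith
  -- The quadratic term `η² P Qᵀ` is absorbed into the linear one through `η‖P‖ ≤ 2w/5`, whence `7/5
  -- = 1 + 2/5`.
  have h4 : frob D ≤ η * w * (p + 7 / 5 * q) := by
    have a1 : frob (P * Vᵀ) ≤ p * w := (frob_mul_le' _ _).trans
      (mul_le_mul_of_nonneg_left (by rwa [norm_transpose]) hp)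
    have a2 : frob (U * Qᵀ) ≤ w * q := (frob_mul_le _ _).trans (by
      rw [frob_transpose]; exact mul_le_mul_of_nonneg_right hU hq)
    have a3 : frob (P * Qᵀ) ≤ ‖P‖ * q := (frob_mul_le _ _).trans (by rw [frob_transpose])
    have a4 := frob_add_le ((-η) • (P * Vᵀ + U * Qᵀ)) (η ^ 2 • (P * Qᵀ))
    rw [← hD, frob_smul, frob_smul, abs_neg, abs_of_nonneg hη, abs_of_nonneg (sq_nonneg η)] at a4
    have a5 := mul_le_mul_of_nonneg_left ((frob_add_le (P * Vᵀ) (U * Qᵀ)).trans (add_le_add a1 a2)) hη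
    have a6 : η ^ 2 * frob (P * Qᵀ) ≤ η * (2 / 5 * w * q) := by
      have b1 := mul_le_mul_of_nonneg_left a3 (sq_nonneg η)
      have b2 := mul_le_mul_of_nonneg_left (mul_le_mul_of_nonneg_right hP hq) hη
      nlinarith
    nlinarith
  have h5 : frobSq D ≤ 3 * (η * w) ^ 2 * (p ^ 2 + q ^ 2) := by
    rw [← frob_sq]
    have b1 := pow_le_pow_left₀ (frob_nonneg D) h4 2
    have b2 : (p + 7 / 5 * q) ^ 2 ≤ 3 * (p ^ 2 + q ^ 2) := by
      nlinarith [sq_nonneg (p - 7 / 5 * q), sq_nonneg (7 / 5 * p - q), sq_nonneg p, sq_nonneg q]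
    have b3 := mul_le_mul_of_nonneg_left b2 (sq_nonneg (η * w))
    rw [mul_pow] at b1
    linarith
  have hG := norm_nonneg G
  have hN : 0 ≤ η * (p ^ 2 + q ^ 2) := by positivity
  have hLw : 0 ≤ L * w ^ 2 := by positivity
  have h6 : η * (L * w ^ 2) ≤ 1 / 15 := by nlinarith [mul_nonneg hη hG]
  have h7 : η * ‖G‖ ≤ 1 / 3 := by nlinarith [mul_nonneg hη hLw]
  have h8 : η ^ 2 * (‖G‖ * q * p) ≤ 1 / 6 * (η * (p ^ 2 + q ^ 2)) := by
    have c1 := mul_le_mul_of_nonneg_right h7 hN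
    have c2 : q * p ≤ (p ^ 2 + q ^ 2) / 2 := by nlinarith [sq_nonneg (p - q)]
    have c3 := mul_le_mul_of_nonneg_left c2 (show 0 ≤ η ^ 2 * ‖G‖ by positivity)
    nlinarith
  have h9 : 2 * L * frobSq D ≤ 2 / 5 * (η * (p ^ 2 + q ^ 2)) := by
    have c1 := mul_le_mul_of_nonneg_right h6 hN
    have c2 := mul_le_mul_of_nonneg_left h5 (show 0 ≤ 2 * L by positivity)
    nlinarith
  rw [hX]
  -- The second-order terms add up to `1/6 + 2/5 = 17/30 ≤ 3/5`.
  have := hf D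
  nlinarith

/-- The imbalance of a pair of factors. -/
def imbalance (U : Matrix (Fin m) (Fin r) ℝ) (V : Matrix (Fin n) (Fin r) ℝ) :
    Matrix (Fin r) (Fin r) ℝ :=
  Uᵀ * U - Vᵀ * V

theorem imbalance_transpose (U : Matrix (Fin m) (Fin r) ℝ) (V : Matrix (Fin n) (Fin r) ℝ) :
    (imbalance U V)ᵀ = imbalance U V := by
  simp [imbalance, transpose_sub, transpose_mul]

theorem norm_imbalance_le {U : Matrix (Fin m) (Fin r) ℝ} {V : Matrix (Fin n) (Fin r) ℝ} {w : ℝ}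
    (hU : ‖U‖ ≤ w) (hV : ‖V‖ ≤ w) : ‖imbalance U V‖ ≤ 2 * w ^ 2 := by
  refine (norm_sub_le _ _).trans ?_
  rw [norm_transpose_mul_self, norm_transpose_mul_self]
  nlinarith [norm_nonneg U, norm_nonneg V]

/-- The effect of a factored step on the balancing term. -/
theorem imbalance_step_le {w η : ℝ} {U P : Matrix (Fin m) (Fin r) ℝ}
    {V Q : Matrix (Fin n) (Fin r) ℝ} (hη : 0 ≤ η) (hU : ‖U‖ ≤ w) (hV : ‖V‖ ≤ w)
    (hstep : η * w ^ 2 ≤ 1 / 15) (hP : η * ‖P‖ ≤ 2 / 5 * w) (hQ : η * ‖Q‖ ≤ 2 / 5 * w) :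
    frobSq (imbalance (U - η • P) (V - η • Q)) ≤ frobSq (imbalance U V)
      - 4 * η * (ip (U * imbalance U V) P - ip (V * imbalance U V) Q)
      + 2 * η * (frobSq P + frobSq Q) := by
  have hw : 0 ≤ w := (norm_nonneg _).trans hU
  have hE := norm_imbalance_le hU hV
  have hET := imbalance_transpose U V
  have hp := frob_nonneg P
  have hq := frob_nonneg Q
  rw [← frob_sq P, ← frob_sq Q]
  set E := imbalance U V with hEdef
  set p := frob P with hpdef
  set q := frob Q with hqdef
  set D := (-η) • (Pᵀ * U + Uᵀ * P - (Qᵀ * V + Vᵀ * Q)) + η ^ 2 • (Pᵀ * P - Qᵀ * Q) with hD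
  have hX : imbalance (U - η • P) (V - η • Q) = E + D := by
    rw [hD, hEdef, imbalance, imbalance, transpose_sub, transpose_smul, transpose_sub,
      transpose_smul]
    simp only [Matrix.sub_mul, Matrix.mul_sub, Matrix.smul_mul, Matrix.mul_smul, smul_smul,
      smul_add, smul_sub, neg_smul, pow_two]
    abel
  have h1 : 2 * ip E D ≤ - 4 * η * (ip (U * E) P - ip (V * E) Q)
      + 4 * (η * w) ^ 2 * (p ^ 2 + q ^ 2) := by
    have a1 : |ip (P * E) P| ≤ 2 * w ^ 2 * p ^ 2 := by
      refine (abs_ip_le _ _).trans ?_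
      have := mul_le_mul_of_nonneg_right ((frob_mul_le' P E).trans
        (mul_le_mul_of_nonneg_left hE hp)) hp
      linarith
    have a2 : |ip (Q * E) Q| ≤ 2 * w ^ 2 * q ^ 2 := by
      refine (abs_ip_le _ _).trans ?_
      have := mul_le_mul_of_nonneg_right ((frob_mul_le' Q E).trans
        (mul_le_mul_of_nonneg_left hE hq)) hq
      linarith
    have a3 : ip (P * E) P - ip (Q * E) Q ≤ 2 * w ^ 2 * (p ^ 2 + q ^ 2) := by
      linarith [(abs_le.1 a1).2, (abs_le.1 a2).1]
    have a4 := mul_le_mul_of_nonneg_left a3 (sq_nonneg η)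
    rw [hD, ip_add_right, ip_smul_right, ip_smul_right, ip_sub_right, ip_add_right, ip_add_right,
      ip_sub_right, ip_transpose_mul E hET, ip_transpose_mul' E hET, ip_transpose_mul E hET,
      ip_transpose_mul' E hET, ip_transpose_mul E hET, ip_transpose_mul E hET]
    linarith
  have bound : ∀ {k : ℕ} (A B : Matrix (Fin k) (Fin r) ℝ), ‖A‖ ≤ w → η * ‖B‖ ≤ 2 / 5 * w →
      frob ((-η) • (Bᵀ * A + Aᵀ * B) + η ^ 2 • (Bᵀ * B)) ≤ 12 / 5 * (η * w) * frob B := by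
    intro k A B hA hB
    have hb := frob_nonneg B
    have a1 : frob (Bᵀ * A) ≤ frob B * w := (frob_mul_le' _ _).trans (by
      rw [frob_transpose]; exact mul_le_mul_of_nonneg_left hA hb)
    have a2 : frob (Aᵀ * B) ≤ w * frob B := (frob_mul_le _ _).trans (by
      rw [norm_transpose]; exact mul_le_mul_of_nonneg_right hA hb)
    have a3 : frob (Bᵀ * B) ≤ ‖B‖ * frob B := (frob_mul_le _ _).trans (by rw [norm_transpose])
    refine (frob_add_le _ _).trans ?_
    rw [frob_smul, frob_smul, abs_neg, abs_of_nonneg hη, abs_of_nonneg (sq_nonneg η)]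
    have a5 := mul_le_mul_of_nonneg_left ((frob_add_le _ _).trans (add_le_add a1 a2)) hη
    have a6 := mul_le_mul_of_nonneg_left a3 (sq_nonneg η)
    have a7 := mul_le_mul_of_nonneg_left (mul_le_mul_of_nonneg_right hB hb) hη
    nlinarith
  have h4 : frob D ≤ 12 / 5 * (η * w) * (p + q) := by
    have a1 : D = ((-η) • (Pᵀ * U + Uᵀ * P) + η ^ 2 • (Pᵀ * P))
        - ((-η) • (Qᵀ * V + Vᵀ * Q) + η ^ 2 • (Qᵀ * Q)) := by
      rw [hD]; simp only [smul_sub]; abel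
    rw [a1]
    refine (frob_sub_le _ _).trans ?_
    linarith [bound U P hU hP, bound V Q hV hQ]
  have h5 : frobSq D ≤ 288 / 25 * (η * w) ^ 2 * (p ^ 2 + q ^ 2) := by
    rw [← frob_sq]
    have b1 := pow_le_pow_left₀ (frob_nonneg D) h4 2
    have b2 : (p + q) ^ 2 ≤ 2 * (p ^ 2 + q ^ 2) := by nlinarith [sq_nonneg (p - q)]
    have b3 := mul_le_mul_of_nonneg_left b2 (sq_nonneg (η * w))
    nlinarith
  -- The second-order terms carry the coefficient `4 + 288/25 < 16`, so the factor `1/15` brings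
  -- them below `2`.
  have h6 : (η * w) ^ 2 * (p ^ 2 + q ^ 2) ≤ 1 / 15 * (η * (p ^ 2 + q ^ 2)) := by
    have := mul_le_mul_of_nonneg_right hstep (show 0 ≤ η * (p ^ 2 + q ^ 2) by positivity)
    nlinarith
  have hN : 0 ≤ η * (p ^ 2 + q ^ 2) := by positivity
  rw [hX, frobSq_add]
  linarith

end

section
variable {m n r : ℕ}

/-- From a balanced point, one iteration of bi-factored gradient descent decreases `f`. -/
theorem descent_of_balanced {f : Matrix (Fin m) (Fin n) ℝ → ℝ} {G : Matrix (Fin m) (Fin n) ℝ}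
    {L w η : ℝ} {U : Matrix (Fin m) (Fin r) ℝ} {V : Matrix (Fin n) (Fin r) ℝ}
    (hf : ∀ D, f (U * Vᵀ + D) ≤ f (U * Vᵀ) + ip G D + 2 * L * frobSq D)
    (hL : 0 ≤ L) (hη : 0 ≤ η) (hU : ‖U‖ ≤ w) (hV : ‖V‖ ≤ w)
    (hstep : η * (15 * L * w ^ 2 + 3 * ‖G‖) ≤ 1) :
    f ((U - η • (G * V)) * (V - η • (Gᵀ * U))ᵀ) ≤ f (U * Vᵀ) := by
  have hw : 0 ≤ w := (norm_nonneg _).trans hU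
  have h7 : η * ‖G‖ ≤ 1 / 3 := by
    have : 0 ≤ η * (L * w ^ 2) := by positivity
    linarith
  have hP : η * ‖G * V‖ ≤ 2 / 5 * w := by
    have h1 := (l2_opNorm_mul G V).trans (mul_le_mul_of_nonneg_left hV (norm_nonneg G))
    have h2 := mul_le_mul_of_nonneg_left h1 hη
    nlinarith
  have h := factored_step_le (Q := Gᵀ * U) hf hL hη hU hV hstep hP
  rw [ip_self, ip_self] at h
  have h1 := mul_nonneg hη (frobSq_nonneg (G * V))
  have h2 := mul_nonneg hη (frobSq_nonneg (Gᵀ * U))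
  linarith

/-- If the smoothness constant is at least `1`, one iteration of bi-factored gradient descent
decreases the balanced objective. -/
theorem descent {f : Matrix (Fin m) (Fin n) ℝ → ℝ} {G : Matrix (Fin m) (Fin n) ℝ}
    {L w η : ℝ} {U : Matrix (Fin m) (Fin r) ℝ} {V : Matrix (Fin n) (Fin r) ℝ}
    (hf : ∀ D, f (U * Vᵀ + D) ≤ f (U * Vᵀ) + ip G D + 2 * L * frobSq D)
    (hL : 1 ≤ L) (hη : 0 ≤ η) (hU : ‖U‖ ≤ w) (hV : ‖V‖ ≤ w)
    (hstep : η * (15 * L * w ^ 2 + 3 * ‖G‖) ≤ 1)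
    {P : Matrix (Fin m) (Fin r) ℝ} {Q : Matrix (Fin n) (Fin r) ℝ}
    (hPdef : P = G * V + (1 / 4 : ℝ) • (U * imbalance U V))
    (hQdef : Q = Gᵀ * U - (1 / 4 : ℝ) • (V * imbalance U V)) :
    f ((U - η • P) * (V - η • Q)ᵀ) + frobSq (imbalance (U - η • P) (V - η • Q)) / 16
      ≤ f (U * Vᵀ) + frobSq (imbalance U V) / 16 := by
  have hw : 0 ≤ w := (norm_nonneg _).trans hU
  have hG := norm_nonneg G
  -- This is where `1 ≤ L` enters: the balancing term needs `η w²` small, while the step size rule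
  -- bounds `η L w²`.
  have h6 : η * w ^ 2 ≤ 1 / 15 := by
    have h0 : 0 ≤ η * ‖G‖ := by positivity
    have h1 : 0 ≤ (L - 1) * (η * w ^ 2) := mul_nonneg (by linarith) (by positivity)
    nlinarith
  have h7 : η * ‖G‖ ≤ 1 / 3 := by
    have : 0 ≤ η * (L * w ^ 2) := by positivity
    linarith
  have hE := norm_imbalance_le hU hV
  have bound : ∀ {k l : ℕ} (H : Matrix (Fin k) (Fin l) ℝ) (A : Matrix (Fin l) (Fin r) ℝ)
      (B : Matrix (Fin k) (Fin r) ℝ), ‖H‖ = ‖G‖ → ‖A‖ ≤ w → ‖B‖ ≤ w →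
      η * (‖H * A‖ + ‖(1 / 4 : ℝ) • (B * imbalance U V)‖) ≤ 2 / 5 * w := by
    intro k l H A B hH hA hB
    have a1 : ‖H * A‖ ≤ ‖G‖ * w := (l2_opNorm_mul H A).trans (by
      rw [hH]; exact mul_le_mul_of_nonneg_left hA hG)
    have a2 : ‖B * imbalance U V‖ ≤ w * (2 * w ^ 2) :=
      (l2_opNorm_mul _ _).trans (mul_le_mul hB hE (norm_nonneg _) hw)
    have a3 : ‖(1 / 4 : ℝ) • (B * imbalance U V)‖ = 1 / 4 * ‖B * imbalance U V‖ := by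
      rw [norm_smul]; norm_num
    have a4 : ‖H * A‖ + 1 / 4 * ‖B * imbalance U V‖ ≤ ‖G‖ * w + 1 / 2 * (w ^ 2 * w) := by linarith
    have a5 := mul_le_mul_of_nonneg_left a4 hη
    have a6 := mul_le_mul_of_nonneg_right h6 hw
    have a7 := mul_le_mul_of_nonneg_right h7 hw
    rw [a3]
    linarith
  have hP : η * ‖P‖ ≤ 2 / 5 * w := by
    rw [hPdef]
    exact (mul_le_mul_of_nonneg_left (norm_add_le _ _) hη).trans (bound G V U rfl hV hU)
  have hQ : η * ‖Q‖ ≤ 2 / 5 * w := by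
    rw [hQdef]
    exact (mul_le_mul_of_nonneg_left (norm_sub_le _ _) hη).trans
      (bound Gᵀ U V (norm_transpose G) hU hV)
  have h1 := factored_step_le (Q := Q) hf (by linarith) hη hU hV hstep hP
  have h2 := imbalance_step_le hη hU hV h6 hP hQ
  have h3 : frobSq P = ip (G * V) P + 1 / 4 * ip (U * imbalance U V) P := by
    rw [← ip_smul_left, ← ip_add_left, ← hPdef, ip_self]
  have h4 : frobSq Q = ip (Gᵀ * U) Q - 1 / 4 * ip (V * imbalance U V) Q := by
    rw [← ip_smul_left, ← ip_sub_left, ← hQdef, ip_self]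
  -- `(P, Q)` is the gradient of the potential, so the first-order decreases of its two terms
  -- combine to `η(|P|² + |Q|²)`. The second-order errors cost only `3/5 + 2/16 < 1` of it.
  have h5 : η * (frobSq P + frobSq Q) = η * (ip (G * V) P + ip (Gᵀ * U) Q)
      + 1 / 4 * (η * (ip (U * imbalance U V) P - ip (V * imbalance U V) Q)) := by
    rw [h3, h4]; ring
  have h8 : 0 ≤ η * (frobSq P + frobSq Q) :=
    mul_nonneg hη (add_nonneg (frobSq_nonneg _) (frobSq_nonneg _))
  linarith

/-! ### The starting point and its distance to the smoothed optimum. -/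

/-- The factors of a truncated singular value decomposition are balanced and bounded. -/
theorem IsSVDFactorization.bounds {X : Matrix (Fin m) (Fin n) ℝ}
    {U : Matrix (Fin m) (Fin r) ℝ} {V : Matrix (Fin n) (Fin r) ℝ}
    (h : IsSVDFactorization X U V) :
    imbalance U V = 0 ∧ ‖U‖ ^ 2 ≤ ‖X‖ ∧ ‖V‖ ^ 2 ≤ ‖X‖ ∧ frob (U * Vᵀ) ≤ frob X := by
  obtain ⟨A, B, hA, hB, -, hXA, rfl, rfl⟩ := h
  set S : Matrix (Fin r) (Fin r) ℝ := diagonal fun k : Fin r => sv X k with hS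
  set R : Matrix (Fin r) (Fin r) ℝ := diagonal fun k : Fin r => √(sv X k) with hR
  have hRR : R * R = S := by
    rw [hR, diagonal_mul_diagonal]
    simp only [Real.mul_self_sqrt (sv_nonneg X _), hS]
  have hRT : Rᵀ = R := diagonal_transpose _
  have hAA : (A * R)ᵀ * (A * R) = S := by
    rw [transpose_mul, hRT, Matrix.mul_assoc, ← Matrix.mul_assoc Aᵀ, hA, Matrix.one_mul, hRR]
  have hBB : (B * R)ᵀ * (B * R) = S := by
    rw [transpose_mul, hRT, Matrix.mul_assoc, ← Matrix.mul_assoc Bᵀ, hB, Matrix.one_mul, hRR]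
  have nA := norm_le_one_of_orthonormal hA
  have nB := norm_le_one_of_orthonormal hB
  have nS : ‖S‖ ≤ ‖X‖ := by
    have h1 : S = Bᵀ * (Xᵀ * A) := by rw [hXA, ← Matrix.mul_assoc, hB, Matrix.one_mul]
    rw [h1]
    have h2 : ‖Xᵀ * A‖ ≤ ‖X‖ := (l2_opNorm_mul _ _).trans (by
      rw [norm_transpose]; nlinarith [norm_nonneg X])
    refine (l2_opNorm_mul _ _).trans ?_
    rw [norm_transpose]
    nlinarith [norm_nonneg (Xᵀ * A)]
  refine ⟨by rw [imbalance, hAA, hBB, sub_self], ?_, ?_, ?_⟩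
  · rw [pow_two, ← norm_transpose_mul_self, hAA]; exact nS
  · rw [pow_two, ← norm_transpose_mul_self, hBB]; exact nS
  -- The product of the factors is `A Aᵀ X`, and multiplying by `Aᵀ` and `A` does not increase the
  -- Frobenius norm.
  · have h1 : A * R * (B * R)ᵀ = A * (Aᵀ * X) := by
      have h2 : Aᵀ * X = (B * S)ᵀ := by rw [← hXA, transpose_mul, transpose_transpose]
      rw [h2, transpose_mul, transpose_mul, hRT, ← hRR, transpose_mul, hRT]
      simp only [Matrix.mul_assoc]
    rw [h1]
    have h3 : frob (Aᵀ * X) ≤ frob X := (frob_mul_le _ _).trans (by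
      rw [norm_transpose]; nlinarith [frob_nonneg X])
    refine (frob_mul_le _ _).trans ?_
    nlinarith [frob_nonneg (Aᵀ * X)]

/-- A pair of factors near an equally-footed factorization of `X` whose distance is controlled by
the least singular value: that singular value is controlled by the factors, and their product is
entrywise close to `X`. -/
theorem DistLE.bounds [NeZero r] {X : Matrix (Fin m) (Fin n) ℝ}
    {U : Matrix (Fin m) (Fin r) ℝ} {V : Matrix (Fin n) (Fin r) ℝ} {a : ℝ}
    (hU : ‖U‖ ^ 2 ≤ a) (hV : ‖V‖ ^ 2 ≤ a)
    (h : DistLE U V X (√2 * √(sv X (r - 1)) / 10)) :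
    sv X (r - 1) ≤ 3 / 2 * a ∧ ∀ i j, |(U * Vᵀ - X) i j| ≤ 3 / 10 * a := by
  obtain ⟨U', V', ⟨hX, hsv⟩, hd⟩ := h
  have hr : r - 1 < r := Nat.sub_lt (NeZero.pos r) one_pos
  set t := √(sv X (r - 1)) with ht
  have ht0 : 0 ≤ t := Real.sqrt_nonneg _
  have hts : sv X (r - 1) = t ^ 2 := (Real.sq_sqrt (sv_nonneg X _)).symm
  have ha : 0 ≤ a := (sq_nonneg _).trans hU
  set b := √a with hb
  have hb0 : 0 ≤ b := Real.sqrt_nonneg _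
  have hab : a = b ^ 2 := (Real.sq_sqrt ha).symm
  rw [hab] at hU hV
  replace hU : ‖U‖ ≤ b := abs_le_of_sq_le_sq' hU hb0 |>.2
  replace hV : ‖V‖ ≤ b := abs_le_of_sq_le_sq' hV hb0 |>.2
  have hdU := frob_nonneg (U - U')
  have hdV := frob_nonneg (V - V')
  rw [← frob_sq, ← frob_sq] at hd
  set x := frob (U - U') with hx
  set y := frob (V - V') with hy
  have hxy : x ^ 2 + y ^ 2 ≤ t ^ 2 / 50 := by
    have h2 := pow_le_pow_left₀ (Real.sqrt_nonneg _) hd 2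
    rw [Real.sq_sqrt (by positivity), div_pow, mul_pow, Real.sq_sqrt (by norm_num)] at h2
    linarith
  have hx7 : x ≤ t / 7 := by
    refine abs_le_of_sq_le_sq' ?_ (by positivity) |>.2
    nlinarith [sq_nonneg y, sq_nonneg t]
  have hxy5 : x + y ≤ t / 5 := by
    refine abs_le_of_sq_le_sq' ?_ (by positivity) |>.2
    nlinarith [sq_nonneg (x - y)]
  have hU' : ‖U'‖ ≤ b + x := by
    have h1 : U' = U - (U - U') := by abel
    calc ‖U'‖ = ‖U - (U - U')‖ := by rw [← h1]
      _ ≤ ‖U‖ + ‖U - U'‖ := norm_sub_le _ _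
      _ ≤ b + x := add_le_add hU (norm_le_frob _)
  -- The least singular value of `U'` is `t`, so `t ≤ ‖U'‖ ≤ b + t/7`: the target cannot be much
  -- larger than the given factors.
  have htU : t ≤ ‖U'‖ := by
    have := (hsv ⟨r - 1, hr⟩).1
    exact (ht.trans this.symm).le.trans (sv_le_norm _ _)
  have htb : t ≤ 7 / 6 * b := by linarith
  refine ⟨?_, fun i j => ?_⟩
  · rw [hts, hab]; nlinarith
  · have h1 : U * Vᵀ - X = (U - U') * Vᵀ + U' * (V - V')ᵀ := by
      rw [← hX, transpose_sub, Matrix.sub_mul, Matrix.mul_sub]; abel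
    refine (abs_entry_le_frob _ i j).trans ?_
    rw [h1]
    refine (frob_add_le _ _).trans ?_
    have h2 : frob ((U - U') * Vᵀ) ≤ x * b := (frob_mul_le' _ _).trans
      (mul_le_mul_of_nonneg_left (by rwa [norm_transpose]) hdU)
    have h3 : frob (U' * (V - V')ᵀ) ≤ (b + x) * y := (frob_mul_le _ _).trans (by
      rw [frob_transpose]; exact mul_le_mul_of_nonneg_right hU' hdV)
    have h4 : x * y ≤ t ^ 2 / 100 := by nlinarith [sq_nonneg (x - y)]
    have h5 : b * (x + y) ≤ b * (t / 5) := mul_le_mul_of_nonneg_left hxy5 hb0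
    rw [hab]
    nlinarith

end

/-! ### Iteration count, monotonicity along the run, and assembly. -/

/-- If more than one iteration is asked for, the smoothness constant is at least `1`. -/
theorem one_le_of_one_lt {ℓ ℓ' e F s : ℝ} (hℓ : 1 / 2 ≤ ℓ) (hℓ' : ℓ' ≤ ℓ) (he : 0 < e) (hF : 0 < F)
    (hs : s ≤ 3 / 2 * (1 / (3 * ℓ / e + 2 * e / (3 * F)))) (hs0 : 0 ≤ s)
    (h : 1 < s * (ℓ' / e ^ 2 + 1 / F)) : 1 ≤ 3 * ℓ / e + 2 * e / (3 * F) := by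
  set L := 3 * ℓ / e + 2 * e / (3 * F) with hL
  have hℓ0 : 0 < ℓ := by linarith
  have hL0 : 0 < L := by positivity
  -- Expanding the square of `L`, whose cross term is `4ℓ/F`, dominates both summands because `ℓ ≥
  -- 1/2`. The factor `2/3` cancels the `3/2` in the bound on `s`, leaving exactly `L`.
  have h1 : ℓ' / e ^ 2 + 1 / F ≤ 2 / 3 * L ^ 2 := by
    have h2 : L ^ 2 = 9 * ℓ ^ 2 / e ^ 2 + 4 * ℓ / F + (2 * e / (3 * F)) ^ 2 := by
      rw [hL]; field_simp; ring
    have h3 : ℓ' / e ^ 2 ≤ 2 / 3 * (9 * ℓ ^ 2 / e ^ 2) := by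
      rw [← mul_div_assoc]
      exact div_le_div_of_nonneg_right (by nlinarith) (by positivity)
    have h4 : 1 / F ≤ 2 / 3 * (4 * ℓ / F) := by
      rw [← mul_div_assoc]
      exact div_le_div_of_nonneg_right (by nlinarith) hF.le
    have h5 := sq_nonneg (2 * e / (3 * F))
    linarith
  have h2 : s * (ℓ' / e ^ 2 + 1 / F) ≤ s * (2 / 3 * L ^ 2) := mul_le_mul_of_nonneg_left h1 hs0
  have h3 : s * (2 / 3 * L ^ 2) ≤ 3 / 2 * (1 / L) * (2 / 3 * L ^ 2) :=
    mul_le_mul_of_nonneg_right hs (by positivity)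
  have h4 : 3 / 2 * (1 / L) * (2 / 3 * L ^ 2) = L := by field_simp
  linarith

theorem neZero_of_opt_pos {m n r : ℕ} {M : Matrix (Fin m) (Fin n) ℝ} (h : 0 < opt r M) :
    NeZero m ∧ NeZero n := by
  by_contra hc
  have hE : IsEmpty (Fin m × Fin n) := by
    rw [not_and_or, not_neZero, not_neZero] at hc
    rcases hc with rfl | rfl <;> infer_instance
  have h0 : ∀ X : Matrix (Fin m) (Fin n) ℝ, entryMax X = 0 := fun X => Real.iSup_of_isEmpty _
  simp [opt, h0] at h

/-- Along a run of bi-factored gradient descent on the smoothed objective, started from an exact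
truncated singular value decomposition, the final value of the objective is at most the initial
one, provided the smoothness constant is at least `1` if there are at least two iterations. -/
theorem IsRun.objective_le {m n r : ℕ} [NeZero m] [NeZero n] {M : Matrix (Fin m) (Fin n) ℝ}
    {τ lam : ℝ} (hτ : 0 < τ) (hlam : 0 ≤ lam) {T : ℕ} {U : ℕ → Matrix (Fin m) (Fin r) ℝ}
    {V : ℕ → Matrix (Fin n) (Fin r) ℝ}
    (h : IsRun (objective M τ lam) T (1 / 4) 1 (1 / τ + lam) U V)
    (hT : 1 < T → 1 ≤ 1 / τ + lam) :
    objective M τ lam (U T * (V T)ᵀ) ≤ objective M τ lam (U 0 * (V 0)ᵀ) := by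
  have hL : 0 ≤ 1 / τ + lam := by positivity
  have hE := h.init.bounds.1
  have hstep : ∀ {η c : ℝ}, 0 < η → η ≤ 1 / c → η * c ≤ 1 := by
    intro η c h1 h2
    -- A zero denominator is excluded: `1 / 0 = 0` would contradict `0 < η`.
    have hc : 0 < c := one_div_pos.1 (h1.trans_le h2)
    rwa [le_div_iff₀ hc] at h2
  rcases Nat.lt_or_ge 1 T with h1 | h1
  · have key : ∀ i ≤ T, objective M τ lam (U i * (V i)ᵀ) + frobSq (imbalance (U i) (V i)) / 16
        ≤ objective M τ lam (U 0 * (V 0)ᵀ) := by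
      intro i
      induction i with
      | zero => intro _; simp [hE, frobSq]
      | succ i ih =>
        intro hi
        obtain ⟨η, hη, hle, hU, hV⟩ := h.step i hi
        refine le_trans ?_ (ih (Nat.le_of_succ_le hi))
        rw [hU, hV]
        refine descent (fun D => objective_add_le M _ D hτ hlam) (hT h1) hη.le
          (norm_le_fromRows_left _ _) (norm_le_fromRows_right _ _) (hstep hη hle) ?_ ?_
        · simp only [imbalance, Matrix.mul_sub]
        · simp only [imbalance, Matrix.mul_sub]
    have h2 := frobSq_nonneg (imbalance (U T) (V T))
    linarith [key T le_rfl]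
  · obtain rfl | rfl : T = 0 ∨ T = 1 := by omega
    · exact le_rfl
    · obtain ⟨η, hη, hle, hU, hV⟩ := h.step 0 one_pos
      -- The balancing terms vanish in the first step, so no lower bound on `L` is required.
      rw [imbalance] at hE
      rw [hE, Matrix.mul_zero, smul_zero, add_zero] at hU
      rw [hE, Matrix.mul_zero, smul_zero, sub_zero] at hV
      rw [zero_add] at hU hV
      rw [hU, hV]
      exact descent_of_balanced (fun D => objective_add_le M _ D hτ hlam) hL hη.le
        (norm_le_fromRows_left _ _) (norm_le_fromRows_right _ _) (hstep hη hle)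

/-- The initial point is nearly optimal for the smoothed objective. -/
theorem objective_init_le {m n r : ℕ} [NeZero m] [NeZero n] [NeZero r]
    {M X : Matrix (Fin m) (Fin n) ℝ} {τ lam : ℝ} (hτ : 0 < τ) (hlam : 0 ≤ lam)
    {U : Matrix (Fin m) (Fin r) ℝ} {V : Matrix (Fin n) (Fin r) ℝ}
    (h : IsSVDFactorization ((1 / (1 / τ + lam)) • (-grad (objective M τ lam) 0)) U V)
    (hd : DistLE U V X (√2 * √(sv X (r - 1)) / 10)) :
    sv X (r - 1) ≤ 3 / 2 * (1 / (1 / τ + lam)) ∧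
      objective M τ lam (U * Vᵀ) ≤ objective M τ lam X + τ / 2 := by
  set L := 1 / τ + lam with hLdef
  have hτi : 0 < 1 / τ := one_div_pos.2 hτ
  have hL : 0 < L := by positivity
  have hX0 : frob ((1 / L) • (-grad (objective M τ lam) 0)) ≤ 1 / L := by
    rw [← neg_one_smul ℝ, frob_smul, frob_smul, abs_of_pos (one_div_pos.2 hL)]
    have := mul_le_mul_of_nonneg_left (frob_grad_zero_le M hτ (lam := lam)) (one_div_pos.2 hL).le
    simpa using this
  obtain ⟨-, hU, hV, hUV⟩ := h.bounds
  have hn := (norm_le_frob _).trans hX0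
  obtain ⟨hs, hclose⟩ := hd.bounds (hU.trans hn) (hV.trans hn)
  refine ⟨hs, ?_⟩
  have h1 : logsumexp (M - U * Vᵀ) τ ≤ logsumexp (M - X) τ + 3 / 10 * (1 / L) := by
    refine logsumexp_le_add hτ fun i j => ?_
    have : M - U * Vᵀ - (M - X) = -(U * Vᵀ - X) := by abel
    rw [this, Matrix.neg_apply, abs_neg]
    exact hclose i j
  have h2 : 1 / L ≤ τ := by
    rw [div_le_iff₀ hL, hLdef, mul_add, mul_one_div_cancel hτ.ne']
    linarith [mul_nonneg hτ.le hlam]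
  have h3 : frobSq (U * Vᵀ) ≤ (1 / L) ^ 2 := by
    rw [← frob_sq]
    exact pow_le_pow_left₀ (frob_nonneg _) (hUV.trans hX0) 2
  -- By AM-GM, `4λ/τ ≤ (1/τ + λ)²`. The total error is then at most `3τ/10 + τ/8 < τ/2`.
  have h4 : lam * (1 / L) ^ 2 ≤ τ / 4 := by
    rw [one_div, inv_pow, ← div_eq_mul_inv, div_le_iff₀ (by positivity)]
    have h5 : 4 * (1 / τ * lam) ≤ L ^ 2 := by
      rw [hLdef]; nlinarith [sq_nonneg (1 / τ - lam)]
    have h6 := mul_le_mul_of_nonneg_left h5 hτ.le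
    have h7 : τ * (4 * (1 / τ * lam)) = 4 * lam := by field_simp
    linarith
  have h5 := mul_le_mul_of_nonneg_left h3 hlam
  have h6 := mul_nonneg hlam (frobSq_nonneg X)
  simp only [objective]
  linarith

end BFGD

theorem corollary5p2 :
    ∃ K : ℝ, 0 < K ∧
      ∀ (m n r : ℕ) (M : Matrix (Fin m) (Fin n) ℝ) (ε : ℝ), 0 < ε → 0 < BFGD.opt r M →
      -- optimal factors of the original problem, with product `X⋆`
      ∀ (Ustar : Matrix (Fin m) (Fin r) ℝ) (Vstar : Matrix (Fin n) (Fin r) ℝ)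
        (Xstar : Matrix (Fin m) (Fin n) ℝ),
        BFGD.IsOptimalFactors (fun X => BFGD.entryMax (M - X)) Ustar Vstar →
        Xstar = Ustar * Vstar.transpose → Xstar ≠ 0 →
      -- optimal factors of the smoothed problem; their product `Xhat` has rank at most `r`, so it
      -- is its own best rank-`r` approximation
      ∀ (Uhat : Matrix (Fin m) (Fin r) ℝ) (Vhat : Matrix (Fin n) (Fin r) ℝ)
        (Xhat : Matrix (Fin m) (Fin n) ℝ),
        BFGD.IsOptimalFactors
          (BFGD.objective M (BFGD.tauParam m n ε (BFGD.opt r M))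
            (BFGD.lamParam ε (BFGD.opt r M) Xstar)) Uhat Vhat →
        Xhat = Uhat * Vhat.transpose →
      ∀ (T : ℕ) (U : ℕ → Matrix (Fin m) (Fin r) ℝ) (V : ℕ → Matrix (Fin n) (Fin r) ℝ),
        T = ⌈K * BFGD.iterBound r ε (BFGD.opt r M) Xstar Xhat⌉₊ →
        BFGD.IsLInfSolverRun M Xstar ε T U V →
        BFGD.DistLE (U 0) (V 0) Xhat (√2 * √(BFGD.sv Xhat (r - 1)) / 10) →
        BFGD.entryMax (M - U T * (V T).transpose) ≤ (1 + ε) * BFGD.opt r M := by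
  refine ⟨1, one_pos, ?_⟩
  intro m n r M ε hε hOPT Ustar Vstar Xstar hstar hXstar hne Uhat Vhat Xhat hhat hXhat T U V hT
    hrun hdist
  obtain ⟨_, _⟩ := BFGD.neZero_of_opt_pos hOPT
  -- For `r = 0` the product `X⋆` would be zero; a positive `r` makes `r - 1` the index of `σ_r`.
  have hr : NeZero r := ⟨by
    rintro rfl
    exact hne (by rw [hXstar]; ext i j; simp [Matrix.mul_apply])⟩
  have hopt : BFGD.entryMax (M - Xstar) ≤ BFGD.opt r M := by
    rw [hXstar]
    exact le_ciInf fun p => hstar p.1 p.2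
  set e := ε * BFGD.opt r M with he
  have he0 : 0 < e := mul_pos hε hOPT
  have hcard := BFGD.two_mul_card_pos m n
  set ℓ := Real.log (2 * (m : ℝ) * (n : ℝ)) with hℓ
  have hℓ2 : 69 / 100 ≤ ℓ := by
    have := Real.log_le_log two_pos hcard
    linarith [Real.log_two_gt_d9]
  have hF : 0 < BFGD.frobSq Xstar := by
    refine lt_of_le_of_ne (BFGD.frobSq_nonneg _) fun h => hne ?_
    ext i j
    have h1 := BFGD.abs_entry_le_frob Xstar i j
    rw [BFGD.frob_eq_sqrt, ← h, Real.sqrt_zero] at h1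
    simpa using h1
  set τ := BFGD.tauParam m n ε (BFGD.opt r M) with hτdef
  set lam := BFGD.lamParam ε (BFGD.opt r M) Xstar with hlamdef
  have hτeq : τ = e / (3 * ℓ) := rfl
  have hτ : 0 < τ := by rw [hτeq]; positivity
  have hτℓ : τ * ℓ = e / 3 := by rw [hτeq]; field_simp
  have hτi : 1 / τ = 3 * ℓ / e := by rw [hτeq, one_div_div]
  have hlameq : lam = 2 * e / (3 * BFGD.frobSq Xstar) := by
    rw [hlamdef, BFGD.lamParam, he, mul_assoc 2]
  have hlam : 0 < lam := by rw [hlameq]; positivity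
  have hlamF : lam / 2 * BFGD.frobSq Xstar = e / 3 := by rw [hlameq]; field_simp
  have hinit := BFGD.objective_init_le hτ hlam.le hrun.init hdist
  have hL : 1 < T → 1 ≤ 1 / τ + lam := by
    intro h
    -- With `K = 1`, having more than one iteration means exactly that the unrounded bound exceeds
    -- `1`.
    rw [hT, Nat.lt_ceil, one_mul, Nat.cast_one, BFGD.iterBound] at h
    have hs := hinit.1
    rw [hτi, hlameq] at hs ⊢
    refine BFGD.one_le_of_one_lt (by linarith) ?_ he0 hF hs (BFGD.sv_nonneg _ _) h
    have h1 : 0 < (m : ℝ) * n := by nlinarith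
    exact Real.log_le_log h1 (by nlinarith)
  have h1 := BFGD.IsRun.objective_le hτ hlam.le hrun hL
  have h2 : BFGD.objective M τ lam Xhat ≤ BFGD.opt r M + e / 3 := by
    refine le_trans (hXhat ▸ hXstar ▸ hhat Ustar Vstar) ?_
    have := BFGD.logsumexp_le_entryMax (M - Xstar) hτ
    simp only [BFGD.objective]
    linarith
  have h3 := BFGD.entryMax_le_logsumexp (M - U T * (V T).transpose) hτ
  rw [← hℓ, hτℓ] at h3
  have h4 : BFGD.logsumexp (M - U T * (V T).transpose) τ
      ≤ BFGD.objective M τ lam (U T * (V T).transpose) := by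
    have := mul_nonneg hlam.le (BFGD.frobSq_nonneg (U T * (V T).transpose))
    simp only [BFGD.objective]
    linarith
  -- Uses `log (2mn) ≥ log 2 > 1/2`.
  have h5 : τ / 2 ≤ e / 3 := by rw [← hτℓ]; nlinarith
  linarith [hinit.2]
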